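/- **Definitions.** Let $M$ be an $n\times n$ matrix over any alphabet, $n\ge 1$. For $1\le b\le n$ let $d_{b\times b}(M)$ be the number of distinct $b\times b$ submatrices (of consecutive rows and columns) of $M$, and let $\delta_{2D}=\delta_{2D}(M)=\max\{d_{b\times b}(M)/b^2 : 1\le b\le n\}$. Note that $1\le\delta_{2D}\le n^2$. Fix an integer $k\ge 2$ and a word size of $w=w(n)$ bits, where $w(n)=\Theta(\log n)$ and a word can hold any integer in $[0,n]$. The two-dimensional block tree (2D-BT) of $M$ is built as follows. Let $k^\alpha$ be the largest power of $k$ with $k^\alpha\le n/\sqrt{\delta_{2D}}$. The root represents $M$, and its children, the nodes of level $0$, are the blocks of the grid of side $k^\alpha$ on $M$ (blocks are cut off at the lower and right border if $k^\alpha\nmid n$). The nodes of level $\ell$ are blocks of the grid of side $b=k^{\alpha-\ell}$. A block of side $b$ is *marked* if it intersects the first occurrence, in row major order, of some $b\times b$ submatrix of $M$. A marked node is split into its (at most) $k^2$ blocks of side $b/k$, which are its children in the next level. An unmarked node is a leaf; it stores references to the (up to four) marked blocks that overlap the first occurrence of its content, and the offset of that occurrence. The splitting ends at the first level at which storing a block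 explicitly, with $b^2\lceil\log_2\sigma\rceil$ bits where $\sigma$ is the number of symbols in $M$, takes no more bits than such a leaf; the nodes of that level store their blocks explicitly. Space is the total number of words stored: $O(1)$ for a leaf and $O(k^2)$ for a marked internal node, plus one reference at the root for each node of level $0$. **Theorem.** 1. For every fixed $k$ and $w(\cdot)$ there is a constant $C$ such that for every $n\ge1$ and every $n\times n$ matrix over any alphabet the 2D-BT uses at most $$C\,\bigl(\delta_{2D}+\sqrt{n\,\delta_{2D}}\bigr)\Bigl(1+\log\frac{n}{\sqrt{\delta_{2D}}}\Bigr)$$ words. 2. For every fixed $k$, $w(\cdot)$ and $\varepsilon>0$ there is a constant $C$ such that for every $n\ge 2$ and every $n\times n$ matrix over any alphabet with $\delta_{2D}\le n^{1-\varepsilon}$ the 2D-BT uses at most $$C\,\bigl(\delta_{2D}+\sqrt{n\,\delta_{2D}}\bigr)\log\frac{n}{\delta_{2D}}$$ words. 3. This space is optimal within a multiplicative factor $O(\log n)$ in the following sense. There are constants $D$ and $c>0$ and sets $\mathcal F_n$ of $n\times n$ matrices over an alphabet of three symbols such that $\delta_{2D}(M)\le D$ for all $n$ and $M\in\mathcal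 F_n$, and for every $n\ge 2$: * for every injective code $\mathcal C:\mathcal F_n\to\{0,1\}^*$ there is $W\in\mathcal F_n$ with $|\mathcal C(W)|\ge c\sqrt n\,\log n$ bits; * for every fixed $k$ and $w(\cdot)$ there is a constant $C$, independent of $n$, such that the 2D-BT of every $M\in\mathcal F_n$ takes at most $C\sqrt n\,\log^2 n$ bits (the number of words times $w(n)$); moreover, for every injective code $\mathcal C:\mathcal F_n\to\{0,1\}^*$ there is $W\in\mathcal F_n$ such that the 2D-BT of every $M\in\mathcal F_n$ takes at most $C\log n\cdot|\mathcal C(W)|$ bits. -/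

import Mathlib

open Asymptotics Filter

universe u

namespace TwoDBlockTree

variable {S : Type u} {n : ℕ}

/-- The `b × b` submatrix of `M` whose topmost left cell is `(r, c)` (cells are numbered from 0). -/
def window (M : Matrix (Fin n) (Fin n) S) (b r c : ℕ) (hr : r + b ≤ n) (hc : c + b ≤ n) :
    Matrix (Fin b) (Fin b) S :=
  M.submatrix (fun i => ⟨r + i, by have := i.isLt; omega⟩)
    (fun j => ⟨c + j, by have := j.isLt; omega⟩)

/-- The number of distinct `b × b` submatrices of `M`. -/
noncomputable def distinctCount (M : Matrix (Fin n) (Fin n) S) (b : ℕ) : ℕ :=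
  {W : Matrix (Fin b) (Fin b) S |
    ∃ (r c : ℕ) (hr : r + b ≤ n) (hc : c + b ≤ n), W = window M b r c hr hc}.ncard

/-- The measure `δ_2D(M)`: the maximum over `b ∈ [1, n]` of (number of distinct `b × b`
submatrices) divided by `b ^ 2`. -/
noncomputable def delta2D (M : Matrix (Fin n) (Fin n) S) : ℝ :=
  ((Finset.Icc 1 n).sup
    (fun b : ℕ => (distinctCount M b : NNReal) / (b : NNReal) ^ 2) : NNReal)

/-- The number of symbols that appear in `M`. -/
noncomputable def alphabetSize (M : Matrix (Fin n) (Fin n) S) : ℕ :=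
  (Set.range (fun p : Fin n × Fin n => M p.1 p.2)).ncard

/-- The `b × b` submatrix of `M` starting at `(r, c)` is the first occurrence, in row major order,
of its content. -/
def IsFirstOcc (M : Matrix (Fin n) (Fin n) S) (b r c : ℕ) : Prop :=
  ∃ (hr : r + b ≤ n) (hc : c + b ≤ n), ∀ (r' c' : ℕ) (hr' : r' + b ≤ n) (hc' : c' + b ≤ n),
    window M b r' c' hr' hc' = window M b r c hr hc → r < r' ∨ (r = r' ∧ c ≤ c')

/-- The block `(I, J)` of side `b` consists of the cells of `M` in rows `I * b, …, I * b + b - 1`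
and columns `J * b, …, J * b + b - 1`. It is cut off at the lower and the right border of `M` if
`b` does not divide `n`. These are the indices of the (nonempty) blocks of side `b`. -/
def blocks (n b : ℕ) : Finset (ℕ × ℕ) :=
  (Finset.range n ×ˢ Finset.range n).filter (fun p => p.1 * b < n ∧ p.2 * b < n)

/-- The block `(I, J)` of side `b` is marked: it intersects the first occurrence, in row major
order, of some `b × b` submatrix of `M`. -/
def IsMarked (M : Matrix (Fin n) (Fin n) S) (b : ℕ) (p : ℕ × ℕ) : Prop :=
  ∃ r c : ℕ, IsFirstOcc M b r c ∧
    (r < (p.1 + 1) * b ∧ p.1 * b < r + b) ∧ (c < (p.2 + 1) * b ∧ p.2 * b < c + b)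

/-- The exponent `α` of the side `k ^ α` of the blocks into which the whole matrix is divided first:
`k ^ α` is the largest power of `k` that is at most `n / √δ_2D`. -/
noncomputable def topExp (M : Matrix (Fin n) (Fin n) S) (k : ℕ) : ℕ :=
  Nat.log k ⌊(n : ℝ) / Real.sqrt (delta2D M)⌋₊

open Classical in
/-- The nodes of the two-dimensional block tree below its root, level by level. The blocks at
level `l` have side `k ^ (topExp M k - l)`. Every block is a node at level `0`; a block at
level `l + 1` is a node if the block of level `l` that contains it is a marked node. -/
noncomputable def nodes (M : Matrix (Fin n) (Fin n) S) (k : ℕ) : ℕ → Finset (ℕ × ℕ)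
  | 0 => blocks n (k ^ topExp M k)
  | l + 1 => (blocks n (k ^ (topExp M k - (l + 1)))).filter (fun p =>
      (p.1 / k, p.2 / k) ∈ nodes M k l ∧ IsMarked M (k ^ (topExp M k - l)) (p.1 / k, p.2 / k))

/-- The number of words of a pointer leaf: references to the (up to) four marked blocks that overlap
the first occurrence, each given by its two block indices, and the two coordinates of the offset of
that first occurrence. (For a block that is cut off at a border, the occurrence is that of the full
square that contains the block and is flush with that border.) -/
def pointerLeafWords : ℕ := 4 * 2 + 2

/-- The number of words of `w` bits that hold a `b × b` block explicitly, symbol by symbol. -/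
noncomputable def explicitWords (M : Matrix (Fin n) (Fin n) S) (w b : ℕ) : ℕ :=
  (b ^ 2 * Nat.clog 2 (alphabetSize M)) ⌈/⌉ w

/-- The exponent of the side of the smallest blocks. The splitting ends at the first level at which
storing a block explicitly takes no more bits than a pointer leaf does (at single cells at the
latest). -/
noncomputable def bottomExp (M : Matrix (Fin n) (Fin n) S) (k w : ℕ) : ℕ :=
  Nat.findGreatest
    (fun e => (k ^ e) ^ 2 * Nat.clog 2 (alphabetSize M) ≤ pointerLeafWords * w) (topExp M k)

/-- The last level of the tree. -/
noncomputable def lastLevel (M : Matrix (Fin n) (Fin n) S) (k w : ℕ) : ℕ :=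
  topExp M k - bottomExp M k w

open Classical in
/-- The number of words stored at the node `p` of level `l`: one word for its kind, and its content.
A node of the last level stores its block explicitly. Above the last level, a marked node stores
`k ^ 2` references to its children, and an unmarked node is a pointer leaf. -/
noncomputable def nodeWords (M : Matrix (Fin n) (Fin n) S) (k w l : ℕ) (p : ℕ × ℕ) : ℕ :=
  1 + if l = lastLevel M k w then explicitWords M w (k ^ bottomExp M k w)
    else if IsMarked M (k ^ (topExp M k - l)) p then 2 * k ^ 2
    else pointerLeafWords

/-- The space, in words of `w` bits, of the two-dimensional block tree of `M` with arity parameter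
`k`: the root stores one reference for each node of level `0`; then come the nodes of all levels. -/
noncomputable def spaceWords (M : Matrix (Fin n) (Fin n) S) (k w : ℕ) : ℕ :=
  2 * (nodes M k 0).card +
    ∑ l ∈ Finset.range (lastLevel M k w + 1), ∑ p ∈ nodes M k l, nodeWords M k w l p

/-- `w n` is an admissible word size, in bits, for `n × n` matrices: a word holds every integer up to
`n`, and `w n = Θ(log n)`. -/
def IsWordSize (w : ℕ → ℕ) : Prop :=
  (∀ n, Nat.size n ≤ w n) ∧ (fun n => (w n : ℝ)) =Θ[atTop] (fun n : ℕ => Real.log n)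

end TwoDBlockTree

/-! A window that contains a first occurrence is a first occurrence itself. So if a block of side
`b` is marked, all `2b × 2b` windows enclosing the responsible `b × b` window are first occurrences,
and there are at most `4 b² δ` of those in total. Away from the border a marked block has `b²` such
windows, and each window serves at most 9 blocks, which leaves `O(δ)` blocks. Along a border only
about `b` windows are guaranteed; combining the resulting bound `O(bδ)` with the trivial bound `O(n
/ b)` for a strip gives `O(√(nδ))`. The corners contribute `O(1)`. This is `card_marked_le`. Every
level then has `O(δ + √(nδ))` nodes of `O(1)` words, and there are `O(1 + log (n / √δ))` levels
(`spaceWords_le`).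

If `δ ≤ n ^ (1 - ε)`, then `log (n / δ) ≥ ε log n`, so the logarithm can be exchanged.

For optimality, `sparseMatrix` puts about `√n` isolated ones in the first row, each free to move
among about `√n` places. Small windows see at most one of them and large windows have few positions
touching row 0, so `δ ≤ 2`; yet there are `2 ^ Ω(√n log n)` such matrices, and counting bit strings
bounds every code from below. -/

namespace TwoDBlockTree

/-! ### Bounds on `δ` and the number of marked blocks of a given side -/

section Counting

variable {S : Type u} {n : ℕ}

lemma windowSet_eq_range (M : Matrix (Fin n) (Fin n) S) {b : ℕ} (hb : 1 ≤ b) :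
    {W : Matrix (Fin b) (Fin b) S |
      ∃ (r c : ℕ) (hr : r + b ≤ n) (hc : c + b ≤ n), W = window M b r c hr hc} =
    Set.range (fun p : {p : Fin n × Fin n // p.1.1 + b ≤ n ∧ p.2.1 + b ≤ n} =>
      window M b p.1.1 p.1.2 p.2.1 p.2.2) := by
  ext W
  constructor
  · rintro ⟨r, c, hr, hc, rfl⟩
    exact ⟨⟨(⟨r, by omega⟩, ⟨c, by omega⟩), hr, hc⟩, rfl⟩
  · rintro ⟨p, rfl⟩
    exact ⟨p.1.1, p.1.2, p.2.1, p.2.2, rfl⟩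

lemma windowSet_finite (M : Matrix (Fin n) (Fin n) S) {b : ℕ} (hb : 1 ≤ b) :
    {W : Matrix (Fin b) (Fin b) S |
      ∃ (r c : ℕ) (hr : r + b ≤ n) (hc : c + b ≤ n), W = window M b r c hr hc}.Finite := by
  rw [windowSet_eq_range M hb]
  exact Set.finite_range _

lemma distinctCount_le_sq (M : Matrix (Fin n) (Fin n) S) {b : ℕ} (hb : 1 ≤ b) :
    distinctCount M b ≤ n ^ 2 := by
  unfold distinctCount
  rw [windowSet_eq_range M hb, ← Nat.card_coe_set_eq]
  refine (Finite.card_range_le _).trans ((Finite.card_subtype_le _).trans ?_)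
  simp [sq]

lemma distinctCount_pos (M : Matrix (Fin n) (Fin n) S) {b : ℕ} (hb : 1 ≤ b) (hbn : b ≤ n) :
    1 ≤ distinctCount M b :=
  (Set.ncard_pos (windowSet_finite M hb)).2
    ⟨_, 0, 0, by omega, by omega, rfl⟩

lemma delta2D_le (M : Matrix (Fin n) (Fin n) S) {D : ℝ} (hD : 0 ≤ D)
    (h : ∀ b, 1 ≤ b → b ≤ n → (distinctCount M b : ℝ) ≤ D * (b : ℝ) ^ 2) :
    delta2D M ≤ D := by
  unfold delta2D
  rw [← Real.coe_toNNReal D hD, NNReal.coe_le_coe]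
  refine Finset.sup_le fun b hb => ?_
  obtain ⟨h1, h2⟩ := Finset.mem_Icc.1 hb
  have hb0 : (0 : ℝ) < (b : ℝ) ^ 2 := by positivity
  rw [← NNReal.coe_le_coe, Real.coe_toNNReal D hD]
  push_cast
  exact (div_le_iff₀ hb0).2 (h b h1 h2)

lemma distinctCount_le_delta2D_mul (M : Matrix (Fin n) (Fin n) S) {b : ℕ} (hb : 1 ≤ b)
    (hbn : b ≤ n) : (distinctCount M b : ℝ) ≤ delta2D M * (b : ℝ) ^ 2 := by
  have hb0 : (0 : ℝ) < (b : ℝ) ^ 2 := by positivity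
  rw [← div_le_iff₀ hb0]
  have := Finset.le_sup (f := fun b : ℕ => (distinctCount M b : NNReal) / (b : NNReal) ^ 2)
    (Finset.mem_Icc.2 ⟨hb, hbn⟩)
  rw [← NNReal.coe_le_coe] at this
  simpa [delta2D] using this

lemma one_le_delta2D (M : Matrix (Fin n) (Fin n) S) (hn : 1 ≤ n) : 1 ≤ delta2D M := by
  have h := distinctCount_le_delta2D_mul M le_rfl hn
  have h1 : (1 : ℝ) ≤ distinctCount M 1 := by exact_mod_cast distinctCount_pos M le_rfl hn
  simp only [Nat.cast_one, one_pow, mul_one] at h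
  linarith

lemma delta2D_le_sq (M : Matrix (Fin n) (Fin n) S) : delta2D M ≤ (n : ℝ) ^ 2 := by
  refine delta2D_le M (by positivity) fun b hb _ => ?_
  have h : (distinctCount M b : ℝ) ≤ (n : ℝ) ^ 2 := by exact_mod_cast distinctCount_le_sq M hb
  have hb' : (1 : ℝ) ≤ (b : ℝ) ^ 2 := one_le_pow₀ (by exact_mod_cast hb)
  nlinarith [sq_nonneg (n : ℝ)]

/-- A window that contains a first occurrence is a first occurrence itself. -/
lemma IsFirstOcc.extend {M : Matrix (Fin n) (Fin n) S} {b r c : ℕ} (h : IsFirstOcc M b r c)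
    {B r' c' : ℕ} (hr : r' ≤ r) (hrb : r + b ≤ r' + B) (hrn : r' + B ≤ n)
    (hc : c' ≤ c) (hcb : c + b ≤ c' + B) (hcn : c' + B ≤ n) : IsFirstOcc M B r' c' := by
  obtain ⟨_, _, hmin⟩ := h
  refine ⟨hrn, hcn, fun r₂ c₂ hr₂ hc₂ heq => ?_⟩
  -- An occurrence of the large window contains one of the small window at the same offset, and a
  -- common shift preserves row major order.
  have := hmin (r₂ + (r - r')) (c₂ + (c - c')) (by omega) (by omega) ?_
  · omega
  · ext i j
    have hi := i.isLt
    have hj := j.isLt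
    have e := congr_fun (congr_fun heq ⟨r - r' + i, by omega⟩) ⟨c - c' + j, by omega⟩
    simp only [window, Matrix.submatrix_apply] at e ⊢
    convert e using 3 <;> omega

open Classical in
/-- The positions of the first occurrences of the `b × b` submatrices. -/
noncomputable def firstOccs (M : Matrix (Fin n) (Fin n) S) (b : ℕ) : Finset (ℕ × ℕ) :=
  (Finset.range n ×ˢ Finset.range n).filter (fun p => IsFirstOcc M b p.1 p.2)

lemma mem_firstOccs {M : Matrix (Fin n) (Fin n) S} {b r c : ℕ} (hb : 1 ≤ b)
    (h : IsFirstOcc M b r c) : (r, c) ∈ firstOccs M b := by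
  obtain ⟨hr, hc, _⟩ := id h
  simp only [firstOccs, Finset.mem_filter, Finset.mem_product, Finset.mem_range]
  exact ⟨⟨by omega, by omega⟩, h⟩

/-- Two first occurrences of the same content would each precede the other, so content determines
position. -/
lemma card_firstOccs_le (M : Matrix (Fin n) (Fin n) S) {b : ℕ} (hb : 1 ≤ b) :
    (firstOccs M b).card ≤ distinctCount M b := by
  classical
  unfold distinctCount
  rw [Set.ncard_eq_toFinset_card _ (windowSet_finite M hb)]
  refine Finset.card_le_card_of_forall_subsingleton
    (fun p W => ∃ (hr : p.1 + b ≤ n) (hc : p.2 + b ≤ n), W = window M b p.1 p.2 hr hc) ?_ ?_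
  · rintro ⟨r, c⟩ hp
    obtain ⟨hr, hc, _⟩ := (Finset.mem_filter.1 hp).2
    exact ⟨_, (Set.Finite.mem_toFinset _).2 ⟨r, c, hr, hc, rfl⟩, hr, hc, rfl⟩
  · rintro W - ⟨r, c⟩ ⟨hp, hr, hc, rfl⟩ ⟨r', c'⟩ ⟨hp', hr', hc', e⟩
    obtain ⟨_, _, h⟩ := (Finset.mem_filter.1 hp).2
    obtain ⟨_, _, h'⟩ := (Finset.mem_filter.1 hp').2
    have h1 := h r' c' hr' hc' e.symm
    have h2 := h' r c hr hc e
    simp only at h1 h2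
    ext <;> simp only <;> omega

/-- The block `p` meets a `b × b` window all of whose enclosing `2b × 2b` windows start in `X`. -/
def MeetsCovered (n b : ℕ) (X : Finset (ℕ × ℕ)) (p : ℕ × ℕ) : Prop :=
  ∃ r c : ℕ, r + b ≤ n ∧ c + b ≤ n ∧
    (r < (p.1 + 1) * b ∧ p.1 * b < r + b) ∧ (c < (p.2 + 1) * b ∧ p.2 * b < c + b) ∧
    ∀ r' c' : ℕ, r' ≤ r → r ≤ r' + b → r' + 2 * b ≤ n → c' ≤ c → c ≤ c' + b → c' + 2 * b ≤ n →
      (r', c') ∈ X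

/-- Marking depends on row major order and is not symmetric under transposition; this weaker
property is. Hence the left and right strips reduce to the upper and lower ones. -/
lemma MeetsCovered.swap {n b : ℕ} {X : Finset (ℕ × ℕ)} {p : ℕ × ℕ} (h : MeetsCovered n b X p) :
    MeetsCovered n b (X.image Prod.swap) p.swap := by
  obtain ⟨r, c, hr, hc, h1, h2, h⟩ := h
  refine ⟨c, r, hc, hr, h2, h1, fun r' c' a1 a2 a3 a4 a5 a6 => ?_⟩
  exact Finset.mem_image.2 ⟨(c', r'), h c' r' a4 a5 a6 a1 a2 a3, rfl⟩

lemma IsMarked.meetsCovered {M : Matrix (Fin n) (Fin n) S} {b : ℕ} (hb : 1 ≤ b) {p : ℕ × ℕ}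
    (h : IsMarked M b p) : MeetsCovered n b (firstOccs M (2 * b)) p := by
  obtain ⟨r, c, hf, h1, h2⟩ := h
  refine ⟨r, c, hf.1, hf.2.1, h1, h2, fun r' c' a1 a2 a3 a4 a5 a6 => ?_⟩
  exact mem_firstOccs (by omega) (hf.extend a1 (by omega) a3 a4 (by omega) a6)

/-- Block indices whose blocks are at distance at least about `2b` from the border. -/
def IsInner (n b I : ℕ) : Prop := 2 ≤ I ∧ (I + 3) * b ≤ n

lemma IsInner.start_bounds {n b I r r' : ℕ} (hI : IsInner n b I) (h1 : r < (I + 1) * b)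
    (h2 : I * b < r + b) (h3 : r' ∈ Finset.Ioc (r - b) r) :
    b ≤ r ∧ r' + 2 * b ≤ n ∧ I ≤ r' / b + 2 ∧ r' / b ≤ I := by
  obtain ⟨hI2, hIn⟩ := hI
  obtain ⟨h3, h4⟩ := Finset.mem_Ioc.1 h3
  obtain ⟨J, rfl⟩ := Nat.exists_eq_add_of_le hI2
  have hb : 0 < b := by
    rcases Nat.eq_zero_or_pos b with rfl | h
    · simp at h1
    · exact h
  have e1 : (2 + J + 1) * b = J * b + 3 * b := by ring
  have e2 : (2 + J) * b = J * b + 2 * b := by ring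
  have e3 : (2 + J + 3) * b = J * b + 5 * b := by ring
  rw [e1] at h1
  rw [e2] at h2
  rw [e3] at hIn
  have hlow : J ≤ r' / b := (Nat.le_div_iff_mul_le hb).2 (by omega)
  have hup : r' / b < 2 + J + 1 := (Nat.div_lt_iff_lt_mul hb).2 (by rw [e1]; omega)
  omega

/-- Double counting between blocks and starting positions of enclosing windows: an inner block has
all `b²` starts in `Ioc (r - b) r ×ˢ Ioc (c - b) c`, and a start determines each block index up to 3
values. -/
lemma card_inner_mul_le {n b : ℕ} {X P : Finset (ℕ × ℕ)}
    (hP : ∀ p ∈ P, MeetsCovered n b X p) (hI : ∀ p ∈ P, IsInner n b p.1)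
    (hJ : ∀ p ∈ P, IsInner n b p.2) : P.card * b ^ 2 ≤ X.card * 9 := by
  classical
  refine Finset.card_mul_le_card_mul (fun p q : ℕ × ℕ =>
    (p.1 ≤ q.1 / b + 2 ∧ q.1 / b ≤ p.1) ∧ (p.2 ≤ q.2 / b + 2 ∧ q.2 / b ≤ p.2)) ?_ ?_
  · intro p hp
    obtain ⟨r, c, hr, hc, h1, h2, h⟩ := hP p hp
    have hbr : b ≤ r := by
      by_contra hlt
      have := (hI p hp).start_bounds h1.1 h1.2 (r' := r) (by
        obtain ⟨h2', _⟩ := hI p hp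
        have : 2 * b ≤ p.1 * b := Nat.mul_le_mul_right b h2'
        rw [Finset.mem_Ioc]; omega)
      omega
    have hbc : b ≤ c := by
      by_contra hlt
      have := (hJ p hp).start_bounds h2.1 h2.2 (r' := c) (by
        obtain ⟨h2', _⟩ := hJ p hp
        have : 2 * b ≤ p.2 * b := Nat.mul_le_mul_right b h2'
        rw [Finset.mem_Ioc]; omega)
      omega
    have hcard : (Finset.Ioc (r - b) r ×ˢ Finset.Ioc (c - b) c).card = b ^ 2 := by
      rw [Finset.card_product, Nat.card_Ioc, Nat.card_Ioc, Nat.sub_sub_self hbr,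
        Nat.sub_sub_self hbc, sq]
    refine hcard.ge.trans (Finset.card_le_card fun q hq => ?_)
    obtain ⟨hq1, hq2⟩ := Finset.mem_product.1 hq
    have b1 := (hI p hp).start_bounds h1.1 h1.2 hq1
    have b2 := (hJ p hp).start_bounds h2.1 h2.2 hq2
    rw [Finset.mem_Ioc] at hq1 hq2
    rw [Finset.mem_bipartiteAbove]
    exact ⟨h q.1 q.2 hq1.2 (by omega) b1.2.1 hq2.2 (by omega) b2.2.1, b1.2.2, b2.2.2⟩
  · intro q _
    refine (Finset.card_le_card (t := Finset.Icc (q.1 / b) (q.1 / b + 2) ×ˢ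
      Finset.Icc (q.2 / b) (q.2 / b + 2)) fun p hp => ?_).trans ?_
    · rw [Finset.mem_bipartiteBelow] at hp
      rw [Finset.mem_product, Finset.mem_Icc, Finset.mem_Icc]
      tauto
    · have e : ∀ a : ℕ, a + 2 + 1 - a = 3 := fun a => by omega
      rw [Finset.card_product, Nat.card_Icc, Nat.card_Icc, e, e]

/-- Near the upper or lower border the row start may have no freedom, so a single row start is used
per block and only the `b` column starts are counted. -/
lemma card_strip_mul_le {n b : ℕ} (hbn : 2 * b ≤ n) {X P : Finset (ℕ × ℕ)} {A : Finset ℕ}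
    (hP : ∀ p ∈ P, MeetsCovered n b X p) (hA : ∀ p ∈ P, p.1 ∈ A)
    (hJ : ∀ p ∈ P, IsInner n b p.2) : P.card * b ≤ X.card * (A.card * 3) := by
  classical
  refine Finset.card_mul_le_card_mul (fun p q : ℕ × ℕ =>
    p.2 ≤ q.2 / b + 2 ∧ q.2 / b ≤ p.2) ?_ ?_
  · intro p hp
    obtain ⟨r, c, hr, hc, h1, h2, h⟩ := hP p hp
    have hbc : b ≤ c := by
      by_contra hlt
      have := (hJ p hp).start_bounds h2.1 h2.2 (r' := c) (by
        obtain ⟨h2', _⟩ := hJ p hp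
        have : 2 * b ≤ p.2 * b := Nat.mul_le_mul_right b h2'
        rw [Finset.mem_Ioc]; omega)
      omega
    -- The start is clamped so that the window stays inside the matrix; it still encloses the small
    -- window because `r + b ≤ n`.
    have hcard : ({min r (n - 2 * b)} ×ˢ Finset.Ioc (c - b) c).card = b := by
      rw [Finset.card_product, Nat.card_Ioc, Nat.sub_sub_self hbc, Finset.card_singleton, one_mul]
    refine hcard.ge.trans (Finset.card_le_card fun q hq => ?_)
    obtain ⟨hq1, hq2⟩ := Finset.mem_product.1 hq
    have b2 := (hJ p hp).start_bounds h2.1 h2.2 hq2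
    rw [Finset.mem_Ioc] at hq2
    rw [Finset.mem_singleton] at hq1
    rw [Finset.mem_bipartiteAbove]
    exact ⟨h q.1 q.2 (by omega) (by omega) (by omega) hq2.2 (by omega) b2.2.1, b2.2.2⟩
  · intro q _
    refine (Finset.card_le_card (t := A ×ˢ Finset.Icc (q.2 / b) (q.2 / b + 2))
      fun p hp => ?_).trans ?_
    · rw [Finset.mem_bipartiteBelow] at hp
      rw [Finset.mem_product, Finset.mem_Icc]
      exact ⟨hA p hp.1, hp.2.2, hp.2.1⟩
    · rw [Finset.card_product, Nat.card_Icc]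
      exact Nat.mul_le_mul_left _ (by omega)

/-- The product of two bounds on `P.card * b`: the double count `15 * X.card`, and `5 * n` from the
size of the strip. Its square root does not depend on which of the two is sharper. -/
lemma sq_card_strip_mul_le {n b : ℕ} (hbn : 2 * b ≤ n) {X P : Finset (ℕ × ℕ)} {A : Finset ℕ}
    (hP : ∀ p ∈ P, MeetsCovered n b X p) (hA : ∀ p ∈ P, p.1 ∈ A) (hAc : A.card ≤ 5)
    (hJ : ∀ p ∈ P, IsInner n b p.2) : (P.card * b) ^ 2 ≤ 75 * (n * X.card) := by
  have h1 : P.card * b ≤ X.card * 15 :=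
    (card_strip_mul_le hbn hP hA hJ).trans (Nat.mul_le_mul_left _ (by omega))
  have h2 : P.card * b ≤ 5 * n := by
    have hsub : P ⊆ A ×ˢ Finset.range (n / b) := fun p hp => by
      obtain ⟨r, c, _, _, h, _⟩ := hP p hp
      have hb : 0 < b := by
        rcases Nat.eq_zero_or_pos b with rfl | h'
        · simp at h
        · exact h'
      rw [Finset.mem_product, Finset.mem_range]
      refine ⟨hA p hp, (Nat.le_div_iff_mul_le hb).2 (le_trans ?_ (hJ p hp).2)⟩
      exact Nat.mul_le_mul_right b (by omega)
    have := Finset.card_le_card hsub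
    rw [Finset.card_product, Finset.card_range] at this
    calc P.card * b ≤ A.card * (n / b) * b := Nat.mul_le_mul_right b this
      _ = A.card * (n / b * b) := by ring
      _ ≤ 5 * n := Nat.mul_le_mul hAc (Nat.div_mul_le_self n b)
  calc (P.card * b) ^ 2 = (P.card * b) * (P.card * b) := sq _
    _ ≤ (X.card * 15) * (5 * n) := Nat.mul_le_mul h1 h2
    _ = 75 * (n * X.card) := by ring

/-- Contains the indices of the blocks of side `b` that are not inner. -/
def outerIndices (n b : ℕ) : Finset ℕ := {0, 1} ∪ Finset.Icc (n / b - 2) (n / b)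

lemma card_outerIndices_le (n b : ℕ) : (outerIndices n b).card ≤ 5 := by
  refine (Finset.card_union_le _ _).trans ?_
  rw [Nat.card_Icc]
  have : ({0, 1} : Finset ℕ).card = 2 := rfl
  omega

lemma mem_outerIndices {n b I : ℕ} (h : I * b < n) (hI : ¬ IsInner n b I) :
    I ∈ outerIndices n b := by
  simp only [outerIndices, Finset.mem_union, Finset.mem_insert, Finset.mem_singleton,
    Finset.mem_Icc]
  by_contra hc
  refine hI ⟨by omega, ?_⟩
  rcases Nat.eq_zero_or_pos b with rfl | hb
  · simp
  · have h1 : I ≤ n / b := (Nat.le_div_iff_mul_le hb).2 h.le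
    exact (Nat.le_div_iff_mul_le hb).1 (by omega)

lemma card_marked_le (M : Matrix (Fin n) (Fin n) S) (hn : 1 ≤ n) {b : ℕ} (hb : 1 ≤ b)
    {P : Finset (ℕ × ℕ)} (hPb : P ⊆ blocks n b) (hP : ∀ p ∈ P, IsMarked M b p) :
    (P.card : ℝ) ≤ 61 * (delta2D M + Real.sqrt (n * delta2D M)) := by
  classical
  have hδ := one_le_delta2D M hn
  have hs : 0 ≤ Real.sqrt (n * delta2D M) := Real.sqrt_nonneg _
  have hblk : ∀ p ∈ P, p.1 * b < n ∧ p.2 * b < n := fun p hp =>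
    (Finset.mem_filter.1 (hPb hp)).2
  -- Without room for a `2b × 2b` window, the grid has at most `2 × 2` blocks.
  by_cases hbn : 2 * b ≤ n
  swap
  · have : P ⊆ Finset.range 2 ×ˢ Finset.range 2 := fun p hp => by
      obtain ⟨h1, h2⟩ := hblk p hp
      simp only [Finset.mem_product, Finset.mem_range]
      constructor <;> by_contra hlt
      · have := Nat.mul_le_mul_right b (not_lt.1 hlt); omega
      · have := Nat.mul_le_mul_right b (not_lt.1 hlt); omega
    have h4 : (P.card : ℝ) ≤ 4 := by exact_mod_cast (Finset.card_le_card this).trans (by simp)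
    linarith
  have hcov : ∀ p ∈ P, MeetsCovered n b (firstOccs M (2 * b)) p := fun p hp =>
    (hP p hp).meetsCovered hb
  set X := firstOccs M (2 * b) with hX
  have hXc : (X.card : ℝ) ≤ 4 * (delta2D M * (b : ℝ) ^ 2) := by
    have h1 : (X.card : ℝ) ≤ distinctCount M (2 * b) := by
      exact_mod_cast card_firstOccs_le M (by omega)
    have h2 := distinctCount_le_delta2D_mul M (b := 2 * b) (by omega) hbn
    push_cast at h2
    linarith
  have hb0 : (0 : ℝ) < (b : ℝ) ^ 2 := by positivity
  -- `X.card ≤ 4 δ b²` turns 75 into 300, and `300 ≤ 18²`.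
  have strip : ∀ N : ℕ, (N * b) ^ 2 ≤ 75 * (n * X.card) →
      (N : ℝ) ≤ 18 * Real.sqrt (n * delta2D M) := by
    intro N hN
    have hN' : ((N : ℝ) * b) ^ 2 ≤ 75 * (n * X.card) := by exact_mod_cast hN
    have h3 : ((N : ℝ) / 18) ^ 2 ≤ n * delta2D M := by
      have : (N : ℝ) ^ 2 * (b : ℝ) ^ 2 ≤ 300 * (n * delta2D M) * (b : ℝ) ^ 2 := by
        have := mul_le_mul_of_nonneg_left hXc (Nat.cast_nonneg (α := ℝ) n)
        nlinarith
      have := le_of_mul_le_mul_right this hb0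
      have h0 : 0 ≤ (n : ℝ) * delta2D M := by positivity
      nlinarith
    have := Real.le_sqrt_of_sq_le h3
    linarith
  set P₁ := P.filter (fun p => IsInner n b p.1 ∧ IsInner n b p.2)
  set P₂ := P.filter (fun p => ¬ IsInner n b p.1 ∧ IsInner n b p.2)
  set P₃ := P.filter (fun p => IsInner n b p.1 ∧ ¬ IsInner n b p.2)
  set P₄ := P.filter (fun p => ¬ IsInner n b p.1 ∧ ¬ IsInner n b p.2)
  have hcard : P.card ≤ P₁.card + P₂.card + P₃.card + P₄.card := by
    have : P ⊆ ((P₁ ∪ P₂) ∪ P₃) ∪ P₄ := fun p hp => by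
      simp only [P₁, P₂, P₃, P₄, Finset.mem_union, Finset.mem_filter]
      tauto
    refine (Finset.card_le_card this).trans ((Finset.card_union_le _ _).trans ?_)
    gcongr
    refine (Finset.card_union_le _ _).trans ?_
    gcongr
    exact Finset.card_union_le _ _
  have c1 : (P₁.card : ℝ) ≤ 36 * delta2D M := by
    have h : P₁.card * b ^ 2 ≤ X.card * 9 := card_inner_mul_le
      (fun p hp => hcov p (Finset.mem_filter.1 hp).1) (fun p hp => (Finset.mem_filter.1 hp).2.1)
      (fun p hp => (Finset.mem_filter.1 hp).2.2)
    have h' : (P₁.card : ℝ) * (b : ℝ) ^ 2 ≤ X.card * 9 := by exact_mod_cast h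
    exact le_of_mul_le_mul_right (by linarith) hb0
  have c2 : (P₂.card : ℝ) ≤ 18 * Real.sqrt (n * delta2D M) := by
    refine strip _ (sq_card_strip_mul_le hbn (A := outerIndices n b)
      (fun p hp => hcov p (Finset.mem_filter.1 hp).1) (fun p hp => ?_)
      (card_outerIndices_le n b) (fun p hp => (Finset.mem_filter.1 hp).2.2))
    have hp := Finset.mem_filter.1 hp
    exact mem_outerIndices (hblk p hp.1).1 hp.2.1
  have c3 : (P₃.card : ℝ) ≤ 18 * Real.sqrt (n * delta2D M) := by
    refine strip _ ?_
    rw [← Finset.card_image_of_injective P₃ Prod.swap_injective,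
      ← Finset.card_image_of_injective X Prod.swap_injective]
    refine sq_card_strip_mul_le hbn (A := outerIndices n b) ?_ ?_ (card_outerIndices_le n b) ?_
    all_goals
      intro p hp
      obtain ⟨q, hq, rfl⟩ := Finset.mem_image.1 hp
      have hq := Finset.mem_filter.1 hq
    · exact (hcov q hq.1).swap
    · exact mem_outerIndices (hblk q hq.1).2 hq.2.2
    · exact hq.2.1
  have c4 : (P₄.card : ℝ) ≤ 25 := by
    have hsub : P₄ ⊆ outerIndices n b ×ˢ outerIndices n b := fun p hp => by
      have hp := Finset.mem_filter.1 hp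
      exact Finset.mem_product.2 ⟨mem_outerIndices (hblk p hp.1).1 hp.2.1,
        mem_outerIndices (hblk p hp.1).2 hp.2.2⟩
    have := Finset.card_le_card hsub
    rw [Finset.card_product] at this
    have h5 := card_outerIndices_le n b
    exact_mod_cast this.trans (Nat.mul_le_mul h5 h5)
  have hcard' : (P.card : ℝ) ≤ P₁.card + P₂.card + P₃.card + P₄.card := by exact_mod_cast hcard
  -- The total is `36 δ + 2 * 18 √(nδ) + 25`; the corner term is absorbed by `1 ≤ δ`, giving `61 =
  -- 36 + 25`.
  linarith

end Counting

/-! ### Nodes per level, number of levels and total space -/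

section Space

variable {S : Type u} {n : ℕ}

lemma one_le_div_sqrt_delta2D (M : Matrix (Fin n) (Fin n) S) (hn : 1 ≤ n) :
    1 ≤ (n : ℝ) / Real.sqrt (delta2D M) := by
  have hδ := one_le_delta2D M hn
  rw [one_le_div (Real.sqrt_pos.2 (by linarith))]
  exact Real.sqrt_le_iff.2 ⟨Nat.cast_nonneg n, delta2D_le_sq M⟩

lemma pow_topExp_le (M : Matrix (Fin n) (Fin n) S) (hn : 1 ≤ n) (k : ℕ) :
    ((k ^ topExp M k : ℕ) : ℝ) ≤ (n : ℝ) / Real.sqrt (delta2D M) := by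
  have h1 := one_le_div_sqrt_delta2D M hn
  refine le_trans ?_ (Nat.floor_le (by linarith))
  exact_mod_cast Nat.pow_log_le_self k (Nat.floor_pos.2 h1).ne'

lemma lt_pow_topExp_succ (M : Matrix (Fin n) (Fin n) S) {k : ℕ} (hk : 2 ≤ k) :
    (n : ℝ) / Real.sqrt (delta2D M) < ((k ^ topExp M k : ℕ) : ℝ) * k := by
  have h := Nat.lt_pow_succ_log_self (b := k) (by omega) ⌊(n : ℝ) / Real.sqrt (delta2D M)⌋₊
  have h' := Nat.lt_of_floor_lt h
  rwa [Nat.succ_eq_add_one, pow_succ, Nat.cast_mul] at h'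

lemma topExp_le (M : Matrix (Fin n) (Fin n) S) (hn : 1 ≤ n) {k : ℕ} (hk : 2 ≤ k) :
    (topExp M k : ℝ) ≤ 2 * Real.log (n / Real.sqrt (delta2D M)) := by
  have h := pow_topExp_le M hn k
  have h2 : (2 : ℝ) ^ topExp M k ≤ n / Real.sqrt (delta2D M) := by
    refine le_trans ?_ h
    exact_mod_cast Nat.pow_le_pow_left hk _
  have h3 := Real.log_le_log (by positivity) h2
  rw [Real.log_pow] at h3
  have := Real.log_two_gt_d9
  have h0 : (0 : ℝ) ≤ topExp M k := Nat.cast_nonneg _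
  nlinarith

/-- Maximality of the top side makes it larger than `n / (k √δ)`, so each block index is below `⌈k
√δ⌉ ≤ (k + 1) √δ`. -/
lemma card_nodes_zero_le (M : Matrix (Fin n) (Fin n) S) (hn : 1 ≤ n) {k : ℕ} (hk : 2 ≤ k) :
    ((nodes M k 0).card : ℝ) ≤ ((k : ℝ) + 1) ^ 2 * delta2D M := by
  have hδ := one_le_delta2D M hn
  set s := Real.sqrt (delta2D M) with hs
  have hs1 : 1 ≤ s := Real.one_le_sqrt.2 hδ
  have hss : s * s = delta2D M := Real.mul_self_sqrt (by linarith)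
  have hlt := lt_pow_topExp_succ M hk
  rw [← hs, div_lt_iff₀ (by linarith)] at hlt
  have key : ∀ I : ℕ, I * k ^ topExp M k < n → I < ⌈(k : ℝ) * s⌉₊ := by
    intro I hI
    rw [Nat.lt_ceil]
    have hI' : (I : ℝ) * ((k ^ topExp M k : ℕ) : ℝ) < n := by exact_mod_cast hI
    have hpos : (0 : ℝ) ≤ ((k ^ topExp M k : ℕ) : ℝ) := Nat.cast_nonneg _
    refine lt_of_mul_lt_mul_right (a := ((k ^ topExp M k : ℕ) : ℝ)) ?_ hpos
    linarith
  have hsub : nodes M k 0 ⊆ Finset.range ⌈(k : ℝ) * s⌉₊ ×ˢ Finset.range ⌈(k : ℝ) * s⌉₊ := by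
    intro p hp
    have hp := (Finset.mem_filter.1 hp).2
    exact Finset.mem_product.2 ⟨Finset.mem_range.2 (key _ hp.1), Finset.mem_range.2 (key _ hp.2)⟩
  have hc := Finset.card_le_card hsub
  rw [Finset.card_product, Finset.card_range] at hc
  have hc' : ((nodes M k 0).card : ℝ) ≤ (⌈(k : ℝ) * s⌉₊ : ℝ) * ⌈(k : ℝ) * s⌉₊ := by
    exact_mod_cast hc
  have hk0 : (0 : ℝ) ≤ k := Nat.cast_nonneg k
  have hceil : (⌈(k : ℝ) * s⌉₊ : ℝ) ≤ (k + 1) * s := by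
    have := Nat.ceil_lt_add_one (a := (k : ℝ) * s) (by positivity)
    linarith
  calc ((nodes M k 0).card : ℝ) ≤ (⌈(k : ℝ) * s⌉₊ : ℝ) * ⌈(k : ℝ) * s⌉₊ := hc'
    _ ≤ ((k + 1) * s) * ((k + 1) * s) :=
      mul_le_mul hceil hceil (Nat.cast_nonneg _) (by positivity)
    _ = ((k : ℝ) + 1) ^ 2 * delta2D M := by rw [← hss]; ring

lemma card_children_le {k : ℕ} (hk : 1 ≤ k) {P Q : Finset (ℕ × ℕ)}
    (h : ∀ p ∈ P, (p.1 / k, p.2 / k) ∈ Q) : P.card ≤ k ^ 2 * Q.card := by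
  refine Finset.card_le_mul_card_image_of_maps_to (f := fun p : ℕ × ℕ => (p.1 / k, p.2 / k)) h _
    fun q _ => ?_
  have hsub : {p ∈ P | (p.1 / k, p.2 / k) = q} ⊆
      Finset.Ico (q.1 * k) ((q.1 + 1) * k) ×ˢ Finset.Ico (q.2 * k) ((q.2 + 1) * k) := by
    intro p hp
    obtain rfl := (Finset.mem_filter.1 hp).2
    simp only [Finset.mem_product, Finset.mem_Ico]
    exact ⟨⟨Nat.div_mul_le_self _ _, (Nat.div_lt_iff_lt_mul hk).1 (Nat.lt_succ_self _)⟩,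
      ⟨Nat.div_mul_le_self _ _, (Nat.div_lt_iff_lt_mul hk).1 (Nat.lt_succ_self _)⟩⟩
  refine (Finset.card_le_card hsub).trans (le_of_eq ?_)
  rw [Finset.card_product, Nat.card_Ico, Nat.card_Ico, ← Nat.sub_mul, ← Nat.sub_mul,
    Nat.add_sub_cancel_left, Nat.add_sub_cancel_left]
  ring

lemma nodes_subset_blocks (M : Matrix (Fin n) (Fin n) S) (k l : ℕ) :
    nodes M k l ⊆ blocks n (k ^ (topExp M k - l)) := by
  cases l with
  | zero => exact subset_rfl
  | succ l =>
    classical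
    exact Finset.filter_subset _ _

/-- Below level 0 every node is one of at most `k²` children of a marked node one level up, so
`card_marked_le` applies there. -/
lemma card_nodes_le (M : Matrix (Fin n) (Fin n) S) (hn : 1 ≤ n) {k : ℕ} (hk : 2 ≤ k) (l : ℕ) :
    ((nodes M k l).card : ℝ) ≤
      61 * ((k : ℝ) + 1) ^ 2 * (delta2D M + Real.sqrt (n * delta2D M)) := by
  classical
  have hδ := one_le_delta2D M hn
  have hs : 0 ≤ Real.sqrt (n * delta2D M) := Real.sqrt_nonneg _
  have hk0 : (0 : ℝ) ≤ k := Nat.cast_nonneg k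
  cases l with
  | zero =>
    refine (card_nodes_zero_le M hn hk).trans ?_
    have h1 : (0 : ℝ) ≤ ((k : ℝ) + 1) ^ 2 := by positivity
    nlinarith [mul_nonneg h1 hs, mul_nonneg h1 (zero_le_one.trans hδ)]
  | succ l =>
    set Q := (nodes M k l).filter (IsMarked M (k ^ (topExp M k - l)))
    have h1 : (nodes M k (l + 1)).card ≤ k ^ 2 * Q.card := by
      refine card_children_le (by omega) fun p hp => ?_
      simp only [nodes, Finset.mem_filter] at hp
      exact Finset.mem_filter.2 hp.2
    have h1' : ((nodes M k (l + 1)).card : ℝ) ≤ (k : ℝ) ^ 2 * Q.card := by exact_mod_cast h1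
    have h2 := card_marked_le M hn (b := k ^ (topExp M k - l)) (Nat.one_le_pow _ _ (by omega))
      (P := Q) ((Finset.filter_subset _ _).trans (nodes_subset_blocks M k l))
      (fun p hp => (Finset.mem_filter.1 hp).2)
    calc ((nodes M k (l + 1)).card : ℝ) ≤ (k : ℝ) ^ 2 * Q.card := h1'
      _ ≤ ((k : ℝ) + 1) ^ 2 * (61 * (delta2D M + Real.sqrt (n * delta2D M))) := by
        gcongr; linarith
      _ = _ := by ring

lemma alphabetSize_le (M : Matrix (Fin n) (Fin n) S) : alphabetSize M ≤ n ^ 2 := by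
  unfold alphabetSize
  rw [← Nat.card_coe_set_eq]
  refine (Finite.card_range_le _).trans ?_
  simp [sq]

lemma explicitWords_bottomExp_le (M : Matrix (Fin n) (Fin n) S) (hn : 1 ≤ n) {w : ℕ}
    (hw : Nat.size n ≤ w) (k : ℕ) : explicitWords M w (k ^ bottomExp M k w) ≤ 10 := by
  have hw0 : 0 < w := lt_of_lt_of_le (Nat.size_pos.2 hn) hw
  have hclog : Nat.clog 2 (alphabetSize M) ≤ 2 * w := by
    refine Nat.clog_le_of_le_pow ((alphabetSize_le M).trans ?_)
    rw [mul_comm, pow_mul]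
    exact Nat.pow_le_pow_left
      ((Nat.lt_size_self n).le.trans (Nat.pow_le_pow_right (by norm_num) hw)) 2
  -- `Nat.findGreatest` returns 0 also when nothing qualifies. Exponent 0 does qualify, since a
  -- symbol fits in `2 * w` bits, so the value found satisfies the predicate.
  have h0 : (k ^ 0) ^ 2 * Nat.clog 2 (alphabetSize M) ≤ pointerLeafWords * w := by
    simp only [pow_zero, one_pow, one_mul, pointerLeafWords]
    omega
  have h := Nat.findGreatest_spec (P := fun e =>
    (k ^ e) ^ 2 * Nat.clog 2 (alphabetSize M) ≤ pointerLeafWords * w) (Nat.zero_le (topExp M k)) h0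
  unfold explicitWords
  rw [ceilDiv_le_iff_le_mul hw0, mul_comm w]
  exact h

lemma nodeWords_le (M : Matrix (Fin n) (Fin n) S) (hn : 1 ≤ n) {w : ℕ}
    (hw : Nat.size n ≤ w) (k l : ℕ) (p : ℕ × ℕ) : nodeWords M k w l p ≤ 11 + 2 * k ^ 2 := by
  have h := explicitWords_bottomExp_le M hn hw k
  unfold nodeWords
  split_ifs
  · omega
  · omega
  · have : pointerLeafWords = 10 := rfl
    omega

lemma spaceWords_le (M : Matrix (Fin n) (Fin n) S) (hn : 1 ≤ n) {k : ℕ} (hk : 2 ≤ k) {w : ℕ}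
    (hw : Nat.size n ≤ w) :
    (spaceWords M k w : ℝ) ≤ 61 * ((k : ℝ) + 1) ^ 2 * (24 + 4 * (k : ℝ) ^ 2) *
      ((delta2D M + Real.sqrt (n * delta2D M)) *
        (1 + Real.log (n / Real.sqrt (delta2D M)))) := by
  set A := 61 * ((k : ℝ) + 1) ^ 2 * (delta2D M + Real.sqrt (n * delta2D M)) with hA
  set x := Real.log (n / Real.sqrt (delta2D M)) with hx
  have hx0 : 0 ≤ x := Real.log_nonneg (one_le_div_sqrt_delta2D M hn)
  have hN := card_nodes_le M hn hk
  have hA0 : 0 ≤ A := (Nat.cast_nonneg _).trans (hN 0)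
  have hsum : ((∑ l ∈ Finset.range (lastLevel M k w + 1),
      ∑ p ∈ nodes M k l, nodeWords M k w l p : ℕ) : ℝ) ≤
      (topExp M k + 1) * (A * (11 + 2 * (k : ℝ) ^ 2)) := by
    push_cast
    calc (∑ l ∈ Finset.range (lastLevel M k w + 1),
        ∑ p ∈ nodes M k l, (nodeWords M k w l p : ℝ))
        ≤ ∑ l ∈ Finset.range (lastLevel M k w + 1), A * (11 + 2 * (k : ℝ) ^ 2) := by
          refine Finset.sum_le_sum fun l _ => ?_
          calc (∑ p ∈ nodes M k l, (nodeWords M k w l p : ℝ))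
              ≤ ∑ p ∈ nodes M k l, (11 + 2 * (k : ℝ) ^ 2) :=
                Finset.sum_le_sum fun p _ => by exact_mod_cast nodeWords_le M hn hw k l p
            _ = (nodes M k l).card * (11 + 2 * (k : ℝ) ^ 2) := by
                rw [Finset.sum_const, nsmul_eq_mul]
            _ ≤ A * (11 + 2 * (k : ℝ) ^ 2) :=
                mul_le_mul_of_nonneg_right (hN l) (by positivity)
      _ = ((lastLevel M k w + 1 : ℕ) : ℝ) * (A * (11 + 2 * (k : ℝ) ^ 2)) := by
          rw [Finset.sum_const, nsmul_eq_mul, Finset.card_range]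
      _ ≤ (topExp M k + 1) * (A * (11 + 2 * (k : ℝ) ^ 2)) := by
          refine mul_le_mul_of_nonneg_right ?_ (by positivity)
          exact_mod_cast Nat.succ_le_succ (Nat.sub_le _ _)
  have htop : (topExp M k : ℝ) + 1 ≤ 2 * (1 + x) := by
    have := topExp_le M hn hk
    linarith
  have h2 : (topExp M k + 1) * (A * (11 + 2 * (k : ℝ) ^ 2)) ≤
      2 * (1 + x) * (A * (11 + 2 * (k : ℝ) ^ 2)) :=
    mul_le_mul_of_nonneg_right htop (by positivity)
  have h3 : 2 * ((nodes M k 0).card : ℝ) ≤ 2 * (A * (1 + x)) := by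
    have := hN 0
    nlinarith [mul_nonneg hA0 hx0]
  have hval : (spaceWords M k w : ℝ) = 2 * ((nodes M k 0).card : ℝ) +
      ((∑ l ∈ Finset.range (lastLevel M k w + 1),
        ∑ p ∈ nodes M k l, nodeWords M k w l p : ℕ) : ℝ) := by
    unfold spaceWords
    push_cast
    ring
  -- The root references and the nodes together give `2 + 2 * (11 + 2 k²) = 24 + 4 k²`.
  calc (spaceWords M k w : ℝ) ≤ 2 * (A * (1 + x)) + 2 * (1 + x) * (A * (11 + 2 * (k : ℝ) ^ 2)) := by
        rw [hval]; linarith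
    _ = _ := by rw [hA]; ring

lemma log_div_sqrt_delta2D_le (M : Matrix (Fin n) (Fin n) S) (hn : 1 ≤ n) :
    Real.log (n / Real.sqrt (delta2D M)) ≤ Real.log n := by
  have h1 := one_le_div_sqrt_delta2D M hn
  refine Real.log_le_log (by linarith) (div_le_self (Nat.cast_nonneg n) ?_)
  exact Real.one_le_sqrt.2 (one_le_delta2D M hn)

lemma one_add_log_le {n : ℕ} (hn : 2 ≤ n) : 1 + Real.log n ≤ 3 * Real.log n := by
  have h1 : Real.log 2 ≤ Real.log n := Real.log_le_log (by norm_num) (by exact_mod_cast hn)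
  have := Real.log_two_gt_d9
  linarith

end Space

/-! ### A large family of matrices with bounded `δ` -/

section Family

/-- The side of the half slots of the matrices `sparseMatrix`. -/
def halfSlot (n : ℕ) : ℕ := Nat.sqrt n + 1

/-- The number of slots of the matrices `sparseMatrix`. -/
def numSlots (n : ℕ) : ℕ := (n / halfSlot n + 1) / 2

/-- The first row is divided into slots of length `2 * halfSlot n`, and there is a single `1` in the
first half of each of them, at the position that `f` gives; all other cells are `0`. -/
def sparseMatrix (n : ℕ) (f : Fin (numSlots n) → Fin (halfSlot n)) :
    Matrix (Fin n) (Fin n) (Fin 3) :=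
  fun i j => if (i : ℕ) = 0 ∧ ∃ t, (j : ℕ) = t * (2 * halfSlot n) + f t then 1 else 0

lemma sparseMatrix_eq_one_iff {n : ℕ} {f : Fin (numSlots n) → Fin (halfSlot n)} {i j : Fin n} :
    sparseMatrix n f i j = 1 ↔ (i : ℕ) = 0 ∧ ∃ t, (j : ℕ) = t * (2 * halfSlot n) + f t := by
  unfold sparseMatrix
  split_ifs with h <;> simp [h]

lemma sparseMatrix_eq_zero_or {n : ℕ} (f : Fin (numSlots n) → Fin (halfSlot n)) (i j : Fin n) :
    sparseMatrix n f i j = 0 ∨ sparseMatrix n f i j = 1 := by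
  unfold sparseMatrix
  split_ifs <;> simp

/-- `numSlots` rounds up, so the last slot may be cut off; its first half, where the `1` lies, still
fits. -/
lemma slot_pos_lt (n : ℕ) (f : Fin (numSlots n) → Fin (halfSlot n)) (t : Fin (numSlots n)) :
    (t : ℕ) * (2 * halfSlot n) + f t < n := by
  have hq := (f t).isLt
  have h1 : 2 * (t : ℕ) + 1 ≤ n / halfSlot n := by
    have := t.isLt
    unfold numSlots at this
    omega
  have h2 := (Nat.mul_le_mul_right (halfSlot n) h1).trans (Nat.div_mul_le_self _ _)
  have h3 : (2 * (t : ℕ) + 1) * halfSlot n = t * (2 * halfSlot n) + halfSlot n := by ring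
  omega

/-- Since ones lie in first halves only, those of different slots are more than `q` apart. -/
lemma slot_eq_of_close {q t t' : ℕ} {x x' : ℕ} (hx : x < q) (hx' : x' < q)
    (h : t * (2 * q) + x ≤ t' * (2 * q) + x' + q) (h' : t' * (2 * q) + x' ≤ t * (2 * q) + x + q) :
    t = t' := by
  rcases lt_trichotomy t t' with hlt | heq | hlt
  · have := Nat.mul_le_mul_right (2 * q) hlt
    rw [Nat.succ_mul] at this
    omega
  · exact heq
  · have := Nat.mul_le_mul_right (2 * q) hlt
    rw [Nat.succ_mul] at this
    omega

lemma sparseMatrix_injective (n : ℕ) : Function.Injective (sparseMatrix n) := by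
  intro f g h
  funext t
  have h1 : sparseMatrix n f ⟨0, by have := slot_pos_lt n f t; omega⟩ ⟨_, slot_pos_lt n f t⟩ = 1 :=
    sparseMatrix_eq_one_iff.2 ⟨rfl, t, rfl⟩
  rw [h] at h1
  obtain ⟨-, t', ht'⟩ := sparseMatrix_eq_one_iff.1 h1
  simp only at ht'
  have hf := (f t).isLt
  have hg := (g t').isLt
  have ht : t = t' := Fin.ext (slot_eq_of_close hf hg (by omega) (by omega))
  subst ht
  exact Fin.ext (by omega)

/-- The `b × b` matrix with a `1` in the top row at column `j` (no `1` if `b ≤ j`) and zeros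
elsewhere. -/
def topOne (b j : ℕ) : Matrix (Fin b) (Fin b) (Fin 3) :=
  fun x y => if (x : ℕ) = 0 ∧ (y : ℕ) = j then 1 else 0

lemma distinctCount_sparseMatrix_le {n : ℕ} (f : Fin (numSlots n) → Fin (halfSlot n)) {b : ℕ}
    (hb : 1 ≤ b) : distinctCount (sparseMatrix n f) b ≤ 2 * b ^ 2 := by
  classical
  set M := sparseMatrix n f with hM
  have hzero : ∀ (r c : ℕ) (hr : r + b ≤ n) (hc : c + b ≤ n), r ≠ 0 →
      window M b r c hr hc = topOne b b := by
    intro r c hr hc h0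
    ext x y
    have hy := y.isLt
    rcases sparseMatrix_eq_zero_or f ⟨r + x, by omega⟩ ⟨c + y, by omega⟩ with h | h
    · simp [window, topOne, hM, h, hy.ne]
    · have := (sparseMatrix_eq_one_iff.1 h).1
      simp only at this
      omega
  -- A window of side at most `halfSlot n` contains at most one `1`, so it is one of `b + 1`
  -- matrices `topOne b j`. For larger sides, `n < b²` already bounds the number of windows that
  -- touch row 0.
  rcases le_or_gt b (halfSlot n) with hbq | hbq
  · have hsub : {W : Matrix (Fin b) (Fin b) (Fin 3) |
        ∃ (r c : ℕ) (hr : r + b ≤ n) (hc : c + b ≤ n), W = window M b r c hr hc} ⊆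
        ((Finset.range (b + 1)).image (topOne b) : Finset _) := by
      rintro W ⟨r, c, hr, hc, rfl⟩
      rw [Finset.mem_coe, Finset.mem_image]
      by_cases h0 : r ≠ 0
      · exact ⟨b, by simp, (hzero r c hr hc h0).symm⟩
      push Not at h0
      subst h0
      by_cases hex : ∃ (j : Fin b) (t : Fin (numSlots n)), c + j = t * (2 * halfSlot n) + f t
      · obtain ⟨j, t, hjt⟩ := hex
        have hj := j.isLt
        refine ⟨j, by rw [Finset.mem_range]; omega, ?_⟩
        ext x y
        have hy := y.isLt
        have hiff : sparseMatrix n f ⟨0 + x, by omega⟩ ⟨c + y, by omega⟩ = 1 ↔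
            (x : ℕ) = 0 ∧ (y : ℕ) = j := by
          rw [sparseMatrix_eq_one_iff]
          simp only [zero_add]
          refine and_congr_right fun _ => ⟨?_, fun e => ⟨t, by rw [e]; exact hjt⟩⟩
          rintro ⟨t', ht'⟩
          have hft := (f t).isLt
          have hft' := (f t').isLt
          have : t = t' := Fin.ext (slot_eq_of_close hft hft' (by omega) (by omega))
          subst this
          omega
        rcases sparseMatrix_eq_zero_or f ⟨0 + x, by omega⟩ ⟨c + y, by omega⟩ with h | h
        · have hn : ¬ ((x : ℕ) = 0 ∧ (y : ℕ) = j) := fun e => by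
            rw [hiff.2 e] at h
            exact absurd h (by decide)
          simp only [topOne, window, hM, Matrix.submatrix_apply, h, if_neg hn]
        · simp only [topOne, window, hM, Matrix.submatrix_apply, h, if_pos (hiff.1 h)]
      · refine ⟨b, by simp, ?_⟩
        ext x y
        have hy := y.isLt
        rcases sparseMatrix_eq_zero_or f ⟨0 + x, by omega⟩ ⟨c + y, by omega⟩ with h | h
        · simp only [topOne, window, hM, Matrix.submatrix_apply, h, hy.ne, and_false, if_false]
        · exact absurd ⟨y, (sparseMatrix_eq_one_iff.1 h).2⟩ hex
    have h1 := Set.ncard_le_ncard hsub (Finset.finite_toSet _)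
    rw [Set.ncard_coe_finset] at h1
    have h2 := h1.trans Finset.card_image_le
    rw [Finset.card_range] at h2
    unfold distinctCount
    nlinarith
  -- The default value is the zero matrix; the index `n` yields it, and so accounts for all windows
  -- below row 0.
  · set g : ℕ → Matrix (Fin b) (Fin b) (Fin 3) := fun c =>
      if h : b ≤ n ∧ c + b ≤ n then window M b 0 c (by omega) h.2 else topOne b b with hg
    have hsub : {W : Matrix (Fin b) (Fin b) (Fin 3) |
        ∃ (r c : ℕ) (hr : r + b ≤ n) (hc : c + b ≤ n), W = window M b r c hr hc} ⊆
        ((Finset.range (n + 1)).image g : Finset _) := by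
      rintro W ⟨r, c, hr, hc, rfl⟩
      rw [Finset.mem_coe, Finset.mem_image]
      by_cases h0 : r ≠ 0
      · refine ⟨n, by simp, ?_⟩
        rw [hzero r c hr hc h0]
        simp only [hg]
        rw [dif_neg (by omega)]
      · push Not at h0
        subst h0
        refine ⟨c, by rw [Finset.mem_range]; omega, ?_⟩
        simp only [hg]
        rw [dif_pos ⟨by omega, hc⟩]
    have h1 := Set.ncard_le_ncard hsub (Finset.finite_toSet _)
    rw [Set.ncard_coe_finset] at h1
    have h2 := h1.trans Finset.card_image_le
    rw [Finset.card_range] at h2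
    have h3 : n < halfSlot n * halfSlot n := Nat.lt_succ_sqrt n
    unfold distinctCount
    nlinarith

lemma delta2D_sparseMatrix_le {n : ℕ} (f : Fin (numSlots n) → Fin (halfSlot n)) :
    delta2D (sparseMatrix n f) ≤ 2 :=
  delta2D_le _ (by norm_num) fun _ hb _ => by exact_mod_cast distinctCount_sparseMatrix_le f hb

/-! ### Lower bound for codes and space of the tree on the family -/

lemma card_le_of_length_le {L : ℕ} (T : Finset (List Bool)) (hT : ∀ l ∈ T, l.length ≤ L) :
    T.card < 2 ^ (L + 1) := by
  classical
  have hsub : T ⊆ (Finset.range (L + 1)).biUnion (fun i =>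
      (Finset.univ : Finset (List.Vector Bool i)).image List.Vector.toList) := by
    intro l hl
    rw [Finset.mem_biUnion]
    exact ⟨l.length, by rw [Finset.mem_range]; have := hT l hl; omega,
      Finset.mem_image.2 ⟨(⟨l, rfl⟩ : List.Vector Bool l.length), Finset.mem_univ _, rfl⟩⟩
  calc T.card ≤ ∑ i ∈ Finset.range (L + 1), 2 ^ i := by
        refine (Finset.card_le_card hsub).trans (Finset.card_biUnion_le.trans ?_)
        refine Finset.sum_le_sum fun i _ => Finset.card_image_le.trans (le_of_eq ?_)
        rw [Finset.card_univ, card_vector, Fintype.card_bool]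
    _ < 2 ^ (L + 1) := Nat.geomSum_lt le_rfl fun i hi => Finset.mem_range.1 hi

/-- Pigeonhole: fewer than `2 ^ m` bit strings are shorter than `m`. For `m = 0` only the existence
of an element is needed. -/
lemma exists_le_length_of_injOn {β : Type*} {F : Set β} {ι : Type*} [Fintype ι] (g : ι → β)
    (hg : Function.Injective g) (hgF : ∀ i, g i ∈ F) (code : β → List Bool)
    (hcode : Set.InjOn code F) {m : ℕ} (hm : 2 ^ m ≤ Fintype.card ι) :
    ∃ W ∈ F, m ≤ (code W).length := by
  classical
  by_contra! hlt
  cases m with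
  | zero =>
    have : 0 < Fintype.card ι := lt_of_lt_of_le (by norm_num) hm
    obtain ⟨i⟩ := Fintype.card_pos_iff.1 this
    exact absurd (hlt _ (hgF i)) (Nat.not_lt_zero _)
  | succ L =>
    have hinj : Function.Injective (fun i => code (g i)) := fun i j h =>
      hg (hcode (hgF i) (hgF j) h)
    have h := card_le_of_length_le (L := L) (Finset.univ.image (fun i => code (g i))) (by
      intro l hl
      obtain ⟨i, -, rfl⟩ := Finset.mem_image.1 hl
      exact Nat.le_of_lt_succ (hlt _ (hgF i)))
    rw [Finset.card_image_of_injective _ hinj, Finset.card_univ] at h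
    omega

/-- The right side is the logarithm of the size of the family. The constant comes from `√n / 8 ≤
numSlots n` and `log n / 2 ≤ log (halfSlot n)`. -/
lemma sqrt_mul_log_le {n : ℕ} (hn : 2 ≤ n) :
    1 / 16 * (Real.sqrt n * Real.log n) ≤ numSlots n * Real.log (halfSlot n) := by
  set q := halfSlot n with hq
  have hn' : (2 : ℝ) ≤ n := by exact_mod_cast hn
  have hs1 : 1 ≤ Real.sqrt n := Real.one_le_sqrt.2 (by linarith)
  have hss : Real.sqrt n * Real.sqrt n = n := Real.mul_self_sqrt (by linarith)
  have hq1 : Real.sqrt n ≤ q := by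
    have : n ≤ q ^ 2 := by rw [sq]; exact (Nat.lt_succ_sqrt n).le
    exact Real.sqrt_le_iff.2 ⟨Nat.cast_nonneg _, by exact_mod_cast this⟩
  have hq2 : (q : ℝ) ≤ 2 * Real.sqrt n := by
    have h1 : (Nat.sqrt n : ℝ) ≤ Real.sqrt n := Real.nat_sqrt_le_real_sqrt
    rw [hq, halfSlot]
    push_cast
    linarith
  have hqn : q ≤ n := by
    have : Nat.sqrt n < n := Nat.sqrt_lt_self (by omega)
    rw [hq, halfSlot]
    omega
  have hT : Real.sqrt n / 8 ≤ numSlots n := by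
    have hq0 : 0 < q := Nat.succ_pos _
    have h1 : n < q * (n / q + 1) := Nat.lt_mul_div_succ n hq0
    have h2 : 1 ≤ n / q := (Nat.one_le_div_iff hq0).2 hqn
    have h3 : n / q ≤ 2 * numSlots n := by
      unfold numSlots
      rw [← hq]
      omega
    have h4 : n ≤ q * (4 * numSlots n) := h1.le.trans (Nat.mul_le_mul_left _ (by omega))
    have h5 : (n : ℝ) ≤ q * (4 * numSlots n) := by exact_mod_cast h4
    have h6 : (0 : ℝ) ≤ numSlots n := Nat.cast_nonneg _
    have h7 : Real.sqrt n * Real.sqrt n ≤ Real.sqrt n * (8 * numSlots n) := by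
      rw [hss]; nlinarith
    have := le_of_mul_le_mul_left h7 (by linarith)
    linarith
  have hlog : Real.log n / 2 ≤ Real.log q := by
    rw [← Real.log_sqrt (by linarith)]
    exact Real.log_le_log (by linarith) hq1
  have hlog0 : 0 ≤ Real.log n := Real.log_nonneg (by linarith)
  calc 1 / 16 * (Real.sqrt n * Real.log n) = Real.sqrt n / 8 * (Real.log n / 2) := by ring
    _ ≤ numSlots n * Real.log q := mul_le_mul hT hlog (by linarith) (Nat.cast_nonneg _)

lemma exists_sparseMatrix_length_ge {n : ℕ} (hn : 2 ≤ n)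
    (code : Matrix (Fin n) (Fin n) (Fin 3) → List Bool)
    (hcode : Set.InjOn code (Set.range (sparseMatrix n))) :
    ∃ W ∈ Set.range (sparseMatrix n),
      1 / 32 * (Real.sqrt n * Real.log n) ≤ ((code W).length : ℝ) := by
  have h := sqrt_mul_log_le hn
  set N := halfSlot n ^ numSlots n with hN
  have hq : 2 ≤ halfSlot n := Nat.succ_le_succ (Nat.sqrt_pos.2 (by omega))
  have hT : numSlots n ≠ 0 := by
    intro h0
    rw [h0, Nat.cast_zero, zero_mul] at h
    have h1 : 0 < Real.log n := Real.log_pos (by exact_mod_cast hn)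
    have h2 : 0 < Real.sqrt n := Real.sqrt_pos.2 (by exact_mod_cast (by omega : 0 < n))
    have := mul_pos h2 h1
    linarith
  have hN2 : 2 ≤ N := hq.trans (Nat.le_self_pow hT _)
  obtain ⟨W, hW, hlen⟩ := exists_le_length_of_injOn (sparseMatrix n) (sparseMatrix_injective n)
    (F := Set.range (sparseMatrix n)) Set.mem_range_self code hcode (m := Nat.log 2 N) (by
      simpa [hN] using Nat.pow_log_le_self 2 (by omega : N ≠ 0))
  refine ⟨W, hW, ?_⟩
  -- Rounding the logarithm down costs at most a factor 2 once it is at least 1, which turns `1 /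
  -- 16` into `1 / 32`.
  have hm1 : 1 ≤ Nat.log 2 N := Nat.log_pos (by norm_num) hN2
  have hlt : (N : ℝ) ≤ 2 ^ (Nat.log 2 N + 1) := by
    exact_mod_cast (Nat.lt_pow_succ_log_self (b := 2) (by norm_num) N).le
  have hlog := Real.log_le_log (by exact_mod_cast (by omega : 0 < N)) hlt
  rw [Real.log_pow, hN, Nat.cast_pow, Real.log_pow, ← hN] at hlog
  have hm1' : (1 : ℝ) ≤ Nat.log 2 N := by exact_mod_cast hm1
  have hlen' : (Nat.log 2 N : ℝ) ≤ (code W).length := by exact_mod_cast hlen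
  have hl2 : Real.log 2 ≤ 1 := by linarith [Real.log_two_lt_d9]
  have : ((Nat.log 2 N + 1 : ℕ) : ℝ) * Real.log 2 ≤ 2 * Nat.log 2 N := by
    push_cast
    nlinarith
  linarith

lemma IsWordSize.exists_le_log {w : ℕ → ℕ} (hw : IsWordSize w) :
    ∃ C : ℝ, 0 < C ∧ ∀ n : ℕ, 2 ≤ n → (w n : ℝ) ≤ C * Real.log n := by
  obtain ⟨C, hC0, hC⟩ := bound_of_isBigO_nat_atTop hw.2.1
  refine ⟨C, hC0, fun n hn => ?_⟩
  have hlog : 0 < Real.log n := Real.log_pos (by exact_mod_cast hn)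
  have := hC (x := n) hlog.ne'
  rwa [Real.norm_of_nonneg (Nat.cast_nonneg _), Real.norm_of_nonneg hlog.le] at this

lemma IsWordSize.exists_sparseMatrix_space_le {w : ℕ → ℕ} (hw : IsWordSize w) {k : ℕ}
    (hk : 2 ≤ k) :
    ∃ C : ℝ, 0 < C ∧ ∀ n : ℕ, 2 ≤ n → ∀ M ∈ Set.range (sparseMatrix n),
      ((spaceWords M k (w n) * w n : ℕ) : ℝ) ≤ C * (Real.sqrt n * Real.log n ^ 2) := by
  obtain ⟨C₀, hC₀, hlog⟩ := hw.exists_le_log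
  set K := 61 * ((k : ℝ) + 1) ^ 2 * (24 + 4 * (k : ℝ) ^ 2) with hK
  have hK0 : 0 < K := by positivity
  refine ⟨K * 12 * C₀, by positivity, ?_⟩
  rintro n hn _ ⟨f, rfl⟩
  have hn1 : 1 ≤ n := by omega
  have hn' : (1 : ℝ) ≤ n := by exact_mod_cast hn1
  set δ := delta2D (sparseMatrix n f) with hδ
  have h1 : 1 ≤ δ := one_le_delta2D _ hn1
  have h2 : δ ≤ 2 := delta2D_sparseMatrix_le f
  have hs : 1 ≤ Real.sqrt n := Real.one_le_sqrt.2 hn'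
  have hss : Real.sqrt n * Real.sqrt n = n := Real.mul_self_sqrt (by linarith)
  have hsum : δ + Real.sqrt (n * δ) ≤ 4 * Real.sqrt n := by
    have : Real.sqrt (n * δ) ≤ 2 * Real.sqrt n := by
      refine Real.sqrt_le_iff.2 ⟨by linarith, ?_⟩
      nlinarith
    linarith
  have hlg : 1 + Real.log (n / Real.sqrt δ) ≤ 3 * Real.log n := by
    have := log_div_sqrt_delta2D_le (sparseMatrix n f) hn1
    linarith [one_add_log_le hn]
  have hlog0 : 0 ≤ Real.log (n / Real.sqrt δ) :=
    Real.log_nonneg (one_le_div_sqrt_delta2D (sparseMatrix n f) hn1)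
  have hsp := spaceWords_le (sparseMatrix n f) hn1 hk (hw.1 n)
  rw [← hK, ← hδ] at hsp
  rw [Nat.cast_mul]
  calc (spaceWords (sparseMatrix n f) k (w n) : ℝ) * w n
      ≤ (K * ((4 * Real.sqrt n) * (3 * Real.log n))) * (C₀ * Real.log n) := by
        refine mul_le_mul (hsp.trans ?_) (hlog n hn) (Nat.cast_nonneg _) ?_
        · exact mul_le_mul_of_nonneg_left
            (mul_le_mul hsum hlg (by linarith) (by positivity)) hK0.le
        · have := Real.log_nonneg hn'
          positivity
    _ = _ := by ring

end Family

end TwoDBlockTree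

theorem mainTheorem4 :
    -- uniform space bound, in words
    (∀ k : ℕ, 2 ≤ k → ∀ w : ℕ → ℕ, TwoDBlockTree.IsWordSize w →
      ∃ C : ℝ, 0 < C ∧ ∀ (S : Type u) (n : ℕ) (M : Matrix (Fin n) (Fin n) S), 1 ≤ n →
        (TwoDBlockTree.spaceWords M k (w n) : ℝ) ≤
          C * ((TwoDBlockTree.delta2D M + Real.sqrt (n * TwoDBlockTree.delta2D M)) *
            (1 + Real.log (n / Real.sqrt (TwoDBlockTree.delta2D M))))) ∧
    -- the same with `log (n / δ)`, for `δ` polynomially smaller than `n`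
    (∀ k : ℕ, 2 ≤ k → ∀ w : ℕ → ℕ, TwoDBlockTree.IsWordSize w → ∀ ε : ℝ, 0 < ε →
      ∃ C : ℝ, 0 < C ∧ ∀ (S : Type u) (n : ℕ) (M : Matrix (Fin n) (Fin n) S), 2 ≤ n →
        TwoDBlockTree.delta2D M ≤ (n : ℝ) ^ (1 - ε) →
        (TwoDBlockTree.spaceWords M k (w n) : ℝ) ≤
          C * ((TwoDBlockTree.delta2D M + Real.sqrt (n * TwoDBlockTree.delta2D M)) *
            Real.log (n / TwoDBlockTree.delta2D M))) ∧
    -- optimality up to a factor `O(log n)`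
    (∃ (D c : ℝ) (F : ∀ n : ℕ, Set (Matrix (Fin n) (Fin n) (Fin 3))), 0 < c ∧
      (∀ n : ℕ, ∀ M ∈ F n, TwoDBlockTree.delta2D M ≤ D) ∧
      (∀ n : ℕ, 2 ≤ n → ∀ code : Matrix (Fin n) (Fin n) (Fin 3) → List Bool,
        Set.InjOn code (F n) →
          ∃ W ∈ F n, c * (Real.sqrt n * Real.log n) ≤ ((code W).length : ℝ)) ∧
      (∀ k : ℕ, 2 ≤ k → ∀ w : ℕ → ℕ, TwoDBlockTree.IsWordSize w →
        ∃ C : ℝ, 0 < C ∧ ∀ n : ℕ, 2 ≤ n →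
          (∀ M ∈ F n, ((TwoDBlockTree.spaceWords M k (w n) * w n : ℕ) : ℝ) ≤
            C * (Real.sqrt n * Real.log n ^ 2)) ∧
          (∀ code : Matrix (Fin n) (Fin n) (Fin 3) → List Bool, Set.InjOn code (F n) →
            ∃ W ∈ F n, ∀ M ∈ F n,
              ((TwoDBlockTree.spaceWords M k (w n) * w n : ℕ) : ℝ) ≤
                C * Real.log n * ((code W).length : ℝ)))) := by
  refine ⟨fun k hk w hw => ?_, fun k hk w hw ε hε => ?_, ?_⟩
  · exact ⟨61 * ((k : ℝ) + 1) ^ 2 * (24 + 4 * (k : ℝ) ^ 2), by positivity,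
      fun S n M hn => TwoDBlockTree.spaceWords_le M hn hk (hw.1 n)⟩
  · refine ⟨61 * ((k : ℝ) + 1) ^ 2 * (24 + 4 * (k : ℝ) ^ 2) * (3 / ε), by positivity,
      fun S n M hn hδ => ?_⟩
    have hn1 : 1 ≤ n := by omega
    have hn0 : (0 : ℝ) < n := by exact_mod_cast hn1
    have hδ1 := TwoDBlockTree.one_le_delta2D M hn1
    refine (TwoDBlockTree.spaceWords_le M hn1 hk (hw.1 n)).trans ?_
    -- The polynomial gap makes `log (n / δ)` comparable to `log n`; the factor `3 / ε` also covers
    -- the summand 1, as `1 + log n ≤ 3 log n`.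
    have hlog : ε * Real.log n ≤ Real.log (n / TwoDBlockTree.delta2D M) := by
      rw [Real.log_div hn0.ne' (by linarith)]
      have := Real.log_le_log (by linarith) hδ
      rw [Real.log_rpow hn0] at this
      linarith
    have h1 : 1 + Real.log (n / Real.sqrt (TwoDBlockTree.delta2D M)) ≤
        3 / ε * Real.log (n / TwoDBlockTree.delta2D M) := by
      have h2 := TwoDBlockTree.log_div_sqrt_delta2D_le M hn1
      have h3 := TwoDBlockTree.one_add_log_le hn
      have h4 : 3 * Real.log n ≤ 3 / ε * Real.log (n / TwoDBlockTree.delta2D M) := by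
        rw [div_mul_eq_mul_div, le_div_iff₀ hε]
        linarith
      linarith
    have hs := Real.sqrt_nonneg (n * TwoDBlockTree.delta2D M)
    rw [mul_assoc _ (3 / ε), mul_left_comm (3 / ε)]
    exact mul_le_mul_of_nonneg_left (mul_le_mul_of_nonneg_left h1 (by linarith)) (by positivity)
  · refine ⟨2, 1 / 32, fun n => Set.range (TwoDBlockTree.sparseMatrix n), by norm_num, ?_, ?_, ?_⟩
    · rintro n _ ⟨f, rfl⟩
      exact TwoDBlockTree.delta2D_sparseMatrix_le f
    · exact fun n hn code hcode => TwoDBlockTree.exists_sparseMatrix_length_ge hn code hcode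
    · intro k hk w hw
      obtain ⟨C, hC, h⟩ := hw.exists_sparseMatrix_space_le hk
      -- The factor 32 inverts the constant of the code bound. The space bound is uniform over the
      -- family, so one word `W` serves every `M`.
      refine ⟨32 * C, by positivity, fun n hn => ?_⟩
      have hlog : 0 ≤ Real.log n := Real.log_nonneg (by exact_mod_cast (by omega : 1 ≤ n))
      have hs := Real.sqrt_nonneg n
      refine ⟨fun M hM => (h n hn M hM).trans ?_, fun code hcode => ?_⟩
      · exact mul_le_mul_of_nonneg_right (by linarith) (by positivity)
      · obtain ⟨W, hW, hlen⟩ := TwoDBlockTree.exists_sparseMatrix_length_ge hn code hcode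
        refine ⟨W, hW, fun M hM => (h n hn M hM).trans ?_⟩
        calc C * (Real.sqrt n * Real.log n ^ 2)
            = 32 * C * Real.log n * (1 / 32 * (Real.sqrt n * Real.log n)) := by ring
          _ ≤ _ := mul_le_mul_of_nonneg_left hlen (by positivity)
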